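/- Let $\mathcal X$ be a topological space with its Borel $\sigma$-algebra (for instance a subset of $\mathbb R^p$), let $\nu$ be a measure on $\mathcal X$, and let $\rho_X$ be a probability measure on $\mathcal X$ that is absolutely continuous with respect to $\nu$ and whose density $p_X=d\rho_X/d\nu$ satisfies $\ell\le p_X\le u$ ($\nu$-almost everywhere), where $0<\ell\le u<\infty$. Let $\psi_1,\psi_2,\dots$ be continuous functions on $\mathcal X$ with $\sup_{j}\|\psi_j\|_\infty\le M<\infty$ that form a complete orthonormal basis of $L^2_\nu$. For $\omega>1/2$ and $1\le J\le\infty$ put $$K_J^\omega(x,y)=\sum_{1\le j\le J} j^{-2\omega}\psi_j(x)\psi_j(y),\qquad (T_{X,J}^\omega g)(x)=\int_{\mathcal X} g(\tau)\,K_J^\omega(\tau,x)\,d\rho_X(\tau)\quad (g\in L^2_{\rho_X}).$$ For a compact positive operator $T$, let $\lambda_1(T)\ge\lambda_2(T)\ge\dots\ge 0$ denote its eigenvalues in decreasing order, counted with multiplicity (and continued by $0$ if there are only finitely many). 1. Let $s>1$ and $T_X=T_{X,\infty}^{s}$, that is, the covariance operator with kernel $\sum_{j\ge1}j^{-2s}\psi_j(x)\psi_j(y)$.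 Then $T_X$ is a well-defined compact positive operator on $L^2_{\rho_X}$, and $\lambda_j(T_X)=\Theta(j^{-2s})$ as $j\to\infty$ (each side is $O$ of the other). 2. For every $\omega>1/2$ and every $1\le J\le\infty$, $T_{X,J}^\omega$ is a well-defined compact positive operator on $L^2_{\rho_X}$, and $$\ell\, j^{-2\omega}\le \lambda_j(T_{X,J}^\omega)\le u\, j^{-2\omega}\qquad\text{for all integers } j \text{ with } 1\le j\le J.$$ In particular the constants do not depend on $J$. -/

import Mathlib

open MeasureTheory Filter Asymptotics

/-- The feature distribution `ρ` is absolutely continuous with respect to `ν`, and its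
Radon-Nikodym derivative lies between `ℓ` and `u`. -/
structure HasDensityBetween {X : Type*} [MeasurableSpace X] (ρ ν : Measure X) (ℓ u : ℝ) :
    Prop where
  absolutelyContinuous : ρ ≪ ν
  bounds : ∀ᵐ x ∂ν, ENNReal.ofReal ℓ ≤ ρ.rnDeriv ν x ∧ ρ.rnDeriv ν x ≤ ENNReal.ofReal u

/-- The functions `ψ 1, ψ 2, …` are continuous, bounded by the common constant `M`, and their
classes form a complete orthonormal system of `L²(ν)`. -/
structure IsBoundedContinuousBasis {X : Type*} [TopologicalSpace X] [MeasurableSpace X]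
    (ν : Measure X) (M : ℝ) (ψ : ℕ+ → X → ℝ) : Prop where
  continuous : ∀ j, Continuous (ψ j)
  bounded : ∀ j x, |ψ j x| ≤ M
  basis : ∃ b : HilbertBasis ℕ+ ℝ (Lp ℝ 2 ν), ∀ j, b j =ᵐ[ν] ψ j

/-- The kernel `K_J^ω(x, y) = ∑_{1 ≤ j ≤ J} j^(-2ω) ψ_j(x) ψ_j(y)`, where `J` is a natural
number or `∞` (that is `⊤`). For bounded `ψ` and `ω > 1/2` the series converges absolutely. -/
noncomputable def sieveKernel {X : Type*} (ψ : ℕ+ → X → ℝ) (ω : ℝ) (J : ℕ∞) (x y : X) : ℝ :=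
  ∑' j : ℕ+, if ((j : ℕ) : ℕ∞) ≤ J then ((j : ℕ) : ℝ) ^ (-2 * ω) * ψ j x * ψ j y else 0

/-- `T` is the covariance operator of the kernel `K` with respect to `ρ`: the bounded operator
on `L²(ρ)` given by `(T g)(x) = ∫ g(τ) K(τ, x) dρ(τ)`, the integrand being integrable. -/
def IsCovarianceOperator {X : Type*} [MeasurableSpace X] (ρ : Measure X) (K : X → X → ℝ)
    (T : Lp ℝ 2 ρ →L[ℝ] Lp ℝ 2 ρ) : Prop :=
  ∀ g : Lp ℝ 2 ρ, (∀ x, Integrable (fun τ => g τ * K τ x) ρ) ∧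
    T g =ᵐ[ρ] fun x => ∫ τ, g τ * K τ x ∂ρ

/-- There is at most one covariance operator of a given kernel. -/
theorem IsCovarianceOperator.unique {X : Type*} [MeasurableSpace X] {ρ : Measure X}
    {K : X → X → ℝ} {T T' : Lp ℝ 2 ρ →L[ℝ] Lp ℝ 2 ρ} (h : IsCovarianceOperator ρ K T)
    (h' : IsCovarianceOperator ρ K T') : T = T' :=
  ContinuousLinearMap.ext fun g => Lp.ext ((h g).2.trans (h' g).2.symm)

/-- The `j`-th eigenvalue (`j ≥ 1`) of a compact positive operator, in decreasing order and
counted with multiplicity: the largest eigenvalue `μ` such that the eigenspaces of the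
eigenvalues `≥ μ` together have dimension at least `j` (and `0` if there is none). -/
noncomputable def orderedEigenvalue {H : Type*} [NormedAddCommGroup H] [InnerProductSpace ℝ H]
    (T : H →L[ℝ] H) (j : ℕ) : ℝ :=
  sSup {μ : ℝ | Module.End.HasEigenvalue (T : H →ₗ[ℝ] H) μ ∧
    (j : Cardinal) ≤ Module.rank ℝ
      (⨆ μ' : Set.Ici μ, Module.End.eigenspace (T : H →ₗ[ℝ] H) (μ' : ℝ) : Submodule ℝ H)}

/-! Let `A` be the inclusion `L²(ν) → L²(ρ)`. The covariance operator with kernel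
`∑ j, a j ψ j (x) ψ j (y)` is `A D A†`, where `D` is the operator on `L²(ν)` that is diagonal in the
orthonormal family `ψ` with entries `a j`. A quantitative form of Ostrowski's theorem, which follows
from the Courant–Fischer principle, says that `λ_j(A D A†) ≤ ‖A‖² λ_j(D)` for `D ≥ 0`. As
`‖A‖² ≤ u` and `λ_j(D) = a j`, this is the upper bound. The two-sided bound on the density makes `A`
invertible with `‖A⁻¹‖² ≤ ℓ⁻¹`, and the same inequality for `D = A⁻¹ (A D A†) (A⁻¹)†` is the lower
bound. -/

section EigenspaceSpan

open Module.End

/-- The span of the eigenspaces of `T` for the eigenvalues in `S`. For `S = Set.Ici c` its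
dimension counts, with multiplicity, the eigenvalues `≥ c`, as in `orderedEigenvalue`. -/
def eigenspaceSpan {R V : Type*} [CommRing R] [AddCommGroup V] [Module R V] (T : Module.End R V)
    (S : Set R) : Submodule R V :=
  ⨆ μ : S, eigenspace T (μ : R)

theorem eigenspace_le_eigenspaceSpan {R V : Type*} [CommRing R] [AddCommGroup V] [Module R V]
    {T : Module.End R V} {S : Set R} {μ : R} (hμ : μ ∈ S) :
    eigenspace T μ ≤ eigenspaceSpan T S :=
  le_iSup (fun μ : S => eigenspace T (μ : R)) ⟨μ, hμ⟩

theorem exists_hasEigenvalue_le_eigenspaceSpan_Ici {R V : Type*} [CommRing R] [LinearOrder R]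
    [AddCommGroup V] [Module R V] {T : Module.End R V} {W : Submodule R V} (hfg : W.FG)
    (hW : W ≠ ⊥) {c : R} (h : W ≤ eigenspaceSpan T (Set.Ici c)) :
    ∃ μ, c ≤ μ ∧ HasEigenvalue T μ ∧ W ≤ eigenspaceSpan T (Set.Ici μ) := by
  classical
  obtain ⟨s, hs⟩ := CompleteLattice.IsCompactElement.exists_finset_of_le_iSup _
    ((Submodule.fg_iff_compact W).mp hfg) _ h
  let t := s.filter fun μ : Set.Ici c => HasEigenvalue T (μ : R)
  have hWt : W ≤ ⨆ μ ∈ t, eigenspace T (μ : R) := by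
    refine hs.trans (iSup₂_le fun μ hμ => ?_)
    by_cases hev : HasEigenvalue T (μ : R)
    · exact le_iSup₂_of_le μ (Finset.mem_filter.mpr ⟨hμ, hev⟩) le_rfl
    · rw [hasEigenvalue_iff, not_not] at hev
      exact hev.trans_le bot_le
  have ht : t.Nonempty := by
    refine Finset.nonempty_iff_ne_empty.mpr fun ht => hW (le_bot_iff.mp ?_)
    simpa [ht] using hWt
  obtain ⟨m, hm, hmin⟩ := t.exists_min_image Subtype.val ht
  exact ⟨m, m.2, (Finset.mem_filter.mp hm).2,
    hWt.trans (iSup₂_le fun μ hμ => eigenspace_le_eigenspaceSpan (hmin μ hμ))⟩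

theorem exists_fg_le_of_natCast_le_rank {K V : Type*} [Field K] [AddCommGroup V] [Module K V]
    {E : Submodule K V} {j : ℕ} (h : (j : Cardinal) ≤ Module.rank K E) :
    ∃ W ≤ E, W.FG ∧ Module.finrank K W = j := by
  obtain ⟨f, hf⟩ := Module.le_rank_iff_exists_linearMap.mp h
  refine ⟨LinearMap.range (E.subtype ∘ₗ f), ?_, Submodule.FG.of_finite, ?_⟩
  · rintro _ ⟨x, rfl⟩
    exact (f x).2
  · rw [LinearMap.finrank_range_of_inj (Subtype.val_injective.comp hf), Module.finrank_fin_fun]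

theorem exists_hasEigenvalue_le_rank_eigenspaceSpan_Ici {K V : Type*} [Field K] [LinearOrder K]
    [AddCommGroup V] [Module K V] {T : Module.End K V} {c : K} {j : ℕ} (hj : j ≠ 0)
    (h : (j : Cardinal) ≤ Module.rank K (eigenspaceSpan T (Set.Ici c))) :
    ∃ μ, c ≤ μ ∧ HasEigenvalue T μ ∧
      (j : Cardinal) ≤ Module.rank K (eigenspaceSpan T (Set.Ici μ)) := by
  obtain ⟨W, hWc, hfg, hWj⟩ := exists_fg_le_of_natCast_le_rank h
  have hW : W ≠ ⊥ := by
    rintro rfl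
    exact hj (hWj.symm.trans (finrank_bot K V))
  obtain ⟨μ, hcμ, hμ, hWμ⟩ := exists_hasEigenvalue_le_eigenspaceSpan_Ici hfg hW hWc
  refine ⟨μ, hcμ, hμ, ?_⟩
  have : Module.Finite K W := Module.Finite.iff_fg.mpr hfg
  rw [← hWj, Module.finrank_eq_rank]
  exact Submodule.rank_mono hWμ

theorem exists_ne_zero_mem_of_natCast_le_rank {K V F : Type*} [Field K] [AddCommGroup V]
    [Module K V] [AddCommGroup F] [Module K F] [FiniteDimensional K F] {W : Submodule K V} {j : ℕ}
    (hW : (j : Cardinal) ≤ Module.rank K W) (L : V →ₗ[K] F) (hF : Module.finrank K F < j) :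
    ∃ g ∈ W, g ≠ 0 ∧ L g = 0 := by
  obtain ⟨f, hf⟩ := Module.le_rank_iff_exists_linearMap.mp hW
  have hker : LinearMap.ker (L ∘ₗ W.subtype ∘ₗ f) ≠ ⊥ :=
    LinearMap.ker_ne_bot_of_finrank_lt (by simpa using hF)
  obtain ⟨x, hx, hx0⟩ := Submodule.exists_mem_ne_zero_of_ne_bot hker
  refine ⟨f x, (f x).2, ?_, by simpa using hx⟩
  simpa using (map_ne_zero_iff f hf).mpr hx0

theorem natCast_le_rank_map {K V V' : Type*} [Field K] [AddCommGroup V] [Module K V]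
    [AddCommGroup V'] [Module K V'] {f : V →ₗ[K] V'} {W : Submodule K V} {j : ℕ}
    (hf : ∀ x ∈ W, f x = 0 → x = 0) (hW : (j : Cardinal) ≤ Module.rank K W) :
    (j : Cardinal) ≤ Module.rank K (W.map f) := by
  obtain ⟨φ, hφ⟩ := Module.le_rank_iff_exists_linearMap.mp hW
  have hinj : Function.Injective (f.submoduleMap W) :=
    (injective_iff_map_eq_zero _).mpr fun x hx =>
      Subtype.ext (hf x x.2 (congrArg Subtype.val hx))
  exact Module.le_rank_iff_exists_linearMap.mpr ⟨f.submoduleMap W ∘ₗ φ, hinj.comp hφ⟩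

end EigenspaceSpan

section Rayleigh

open Module.End

variable {H : Type*} [NormedAddCommGroup H] [InnerProductSpace ℝ H]

theorem exists_rayleigh_decomposition {T : H →ₗ[ℝ] H} (hT : T.IsSymmetric) {S : Set ℝ} {g : H}
    (hg : g ∈ eigenspaceSpan T S) :
    ∃ (s : Finset S) (w : S → ℝ), (∀ μ, 0 ≤ w μ) ∧ ‖g‖ ^ 2 = ∑ μ ∈ s, w μ ∧
      inner ℝ (T g) g = ∑ μ ∈ s, (μ : ℝ) * w μ := by
  classical
  obtain ⟨f, rfl⟩ := (Submodule.mem_iSup_iff_exists_dfinsupp' _ _).mp hg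
  have horth := hT.orthogonalFamily_eigenspaces.comp (Subtype.val_injective (p := (· ∈ S)))
  have hTf : T (f.sum fun _ x => (x : H)) = ∑ μ ∈ f.support, (((μ : ℝ) • f μ :
      eigenspace T (μ : ℝ)) : H) := by
    simp only [DFinsupp.sum, map_sum, Submodule.coe_smul,
      fun μ => mem_eigenspace_iff.mp (f μ).2]
  refine ⟨f.support, fun μ => ‖f μ‖ ^ 2, fun μ => sq_nonneg _, ?_, ?_⟩
  · exact horth.norm_sum f f.support
  · rw [hTf]
    refine (horth.inner_sum (fun μ => (μ : ℝ) • f μ) f f.support).trans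
      (Finset.sum_congr rfl fun μ _ => ?_)
    rw [real_inner_smul_left, real_inner_self_eq_norm_sq]

theorem inner_le_of_mem_eigenspaceSpan {T : H →ₗ[ℝ] H} (hT : T.IsSymmetric) {S : Set ℝ} {c : ℝ}
    (hS : ∀ μ ∈ S, μ ≤ c) {g : H} (hg : g ∈ eigenspaceSpan T S) :
    inner ℝ (T g) g ≤ c * ‖g‖ ^ 2 := by
  obtain ⟨s, w, hw, hnorm, hinner⟩ := exists_rayleigh_decomposition hT hg
  rw [hnorm, hinner, Finset.mul_sum]
  exact Finset.sum_le_sum fun μ _ => mul_le_mul_of_nonneg_right (hS μ μ.2) (hw μ)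

theorem le_inner_of_mem_eigenspaceSpan {T : H →ₗ[ℝ] H} (hT : T.IsSymmetric) {S : Set ℝ} {c : ℝ}
    (hS : ∀ μ ∈ S, c ≤ μ) {g : H} (hg : g ∈ eigenspaceSpan T S) :
    c * ‖g‖ ^ 2 ≤ inner ℝ (T g) g := by
  obtain ⟨s, w, hw, hnorm, hinner⟩ := exists_rayleigh_decomposition hT hg
  rw [hnorm, hinner, Finset.mul_sum]
  exact Finset.sum_le_sum fun μ _ => mul_le_mul_of_nonneg_right (hS μ μ.2) (hw μ)

theorem isOrtho_eigenspaceSpan {𝕜 E : Type*} [RCLike 𝕜] [NormedAddCommGroup E]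
    [InnerProductSpace 𝕜 E] {T : E →ₗ[𝕜] E} (hT : T.IsSymmetric) {S S' : Set 𝕜}
    (h : Disjoint S S') : eigenspaceSpan T S ⟂ eigenspaceSpan T S' :=
  Submodule.isOrtho_iSup_left.mpr fun μ => Submodule.isOrtho_iSup_right.mpr fun μ' =>
    hT.orthogonalFamily_eigenspaces.isOrtho (h.ne_of_mem μ.2 μ'.2)

theorem orthogonal_eigenspaceSpan {𝕜 E : Type*} [RCLike 𝕜] [NormedAddCommGroup E]
    [InnerProductSpace 𝕜 E] [CompleteSpace E] {T : E →L[𝕜] E} (hc : IsCompactOperator T)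
    (hT : (T : E →ₗ[𝕜] E).IsSymmetric) (S : Set 𝕜) :
    (eigenspaceSpan (T : Module.End 𝕜 E) S)ᗮ =
      (eigenspaceSpan (T : Module.End 𝕜 E) Sᶜ).topologicalClosure := by
  set K := eigenspaceSpan (T : Module.End 𝕜 E) S
  set F := eigenspaceSpan (T : Module.End 𝕜 E) Sᶜ
  have hF : F.topologicalClosure ≤ Kᗮ :=
    Submodule.topologicalClosure_minimal _
      (isOrtho_eigenspaceSpan hT disjoint_compl_left) (Submodule.isClosed_orthogonal _)
  have hKF : Kᗮ ⊓ Fᗮ = ⊥ := by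
    rw [Submodule.inf_orthogonal, eq_bot_iff,
      ← ContinuousLinearMap.orthogonalComplement_iSup_eigenspaces_eq_bot hc hT]
    refine Submodule.orthogonal_le (iSup_le fun μ => ?_)
    by_cases hμ : μ ∈ S
    · exact (eigenspace_le_eigenspaceSpan hμ).trans le_sup_left
    · exact (eigenspace_le_eigenspaceSpan (S := Sᶜ) hμ).trans le_sup_right
  have : CompleteSpace F.topologicalClosure :=
    (Submodule.isClosed_topologicalClosure _).completeSpace_coe
  rw [← Submodule.sup_orthogonal_inf_of_hasOrthogonalProjection hF, Submodule.orthogonal_closure,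
    inf_comm, hKF, sup_bot_eq]

theorem inner_le_of_mem_orthogonal_eigenspaceSpan_Ici [CompleteSpace H] {T : H →L[ℝ] H}
    (hc : IsCompactOperator T) (hT : (T : H →ₗ[ℝ] H).IsSymmetric) {c : ℝ} {g : H}
    (hg : g ∈ (eigenspaceSpan (T : Module.End ℝ H) (Set.Ici c))ᗮ) :
    inner ℝ (T g) g ≤ c * ‖g‖ ^ 2 := by
  rw [orthogonal_eigenspaceSpan hc hT, Set.compl_Ici] at hg
  have hclosed : IsClosed {x : H | inner ℝ (T x) x ≤ c * ‖x‖ ^ 2} :=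
    isClosed_le (by fun_prop) (by fun_prop)
  exact closure_minimal
    (fun x hx => inner_le_of_mem_eigenspaceSpan hT (fun μ (hμ : μ < c) => hμ.le) hx) hclosed hg

end Rayleigh

section OrderedEigenvalue

open Module.End

variable {H : Type*} [NormedAddCommGroup H] [InnerProductSpace ℝ H] {T : H →L[ℝ] H} {j : ℕ}

theorem norm_le_norm_of_hasEigenvalue {𝕜 E : Type*} [NontriviallyNormedField 𝕜]
    [NormedAddCommGroup E] [NormedSpace 𝕜 E] {T : E →L[𝕜] E} {μ : 𝕜}
    (h : HasEigenvalue (T : E →ₗ[𝕜] E) μ) : ‖μ‖ ≤ ‖T‖ := by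
  obtain ⟨v, hv, hv0⟩ := h.exists_hasEigenvector
  have hTv : T v = μ • v := mem_eigenspace_iff.mp hv
  have hle : ‖μ‖ * ‖v‖ ≤ ‖T‖ * ‖v‖ := by
    simpa only [hTv, norm_smul] using T.le_opNorm v
  exact le_of_mul_le_mul_right hle (norm_pos_iff.mpr hv0)

theorem le_orderedEigenvalue_of_le_rank (hj : j ≠ 0) {c : ℝ}
    (h : (j : Cardinal) ≤ Module.rank ℝ (eigenspaceSpan (T : Module.End ℝ H) (Set.Ici c))) :
    c ≤ orderedEigenvalue T j := by
  obtain ⟨μ, hcμ, hμ, hrank⟩ := exists_hasEigenvalue_le_rank_eigenspaceSpan_Ici hj h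
  exact hcμ.trans (le_csSup
    ⟨‖T‖, fun _ hx => (le_abs_self _).trans (norm_le_norm_of_hasEigenvalue hx.1)⟩ ⟨hμ, hrank⟩)

theorem orderedEigenvalue_nonneg (hT : T.IsPositive) : 0 ≤ orderedEigenvalue T j :=
  Real.sSup_nonneg fun _ hμ =>
    eigenvalue_nonneg_of_nonneg hμ.1 fun x => hT.inner_nonneg_right x

theorem le_orderedEigenvalue_of_forall_mem_le_inner [CompleteSpace H] (hc : IsCompactOperator T)
    (hT : (T : H →ₗ[ℝ] H).IsSymmetric) (hj : j ≠ 0) {W : Submodule ℝ H}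
    (hW : (j : Cardinal) ≤ Module.rank ℝ W) {C : ℝ}
    (h : ∀ g ∈ W, C * ‖g‖ ^ 2 ≤ inner ℝ (T g) g) : C ≤ orderedEigenvalue T j := by
  refine le_of_forall_lt_imp_le_of_dense fun c hcC => le_orderedEigenvalue_of_le_rank hj ?_
  set E := eigenspaceSpan (T : Module.End ℝ H) (Set.Ici c)
  by_contra! hlt
  have hfin : FiniteDimensional ℝ E :=
    Module.rank_lt_aleph0_iff.mp (hlt.trans Cardinal.natCast_lt_aleph0)
  have hfinrank : Module.finrank ℝ E < j := by
    rw [← Module.finrank_eq_rank] at hlt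
    exact_mod_cast hlt
  obtain ⟨g, hgW, hg0, hgE⟩ := exists_ne_zero_mem_of_natCast_le_rank hW
    (E.orthogonalProjectionOnto : H →ₗ[ℝ] E) hfinrank
  have hg : C * ‖g‖ ^ 2 ≤ c * ‖g‖ ^ 2 := (h g hgW).trans
    (inner_le_of_mem_orthogonal_eigenspaceSpan_Ici hc hT (by simpa using hgE))
  exact hcC.not_ge (le_of_mul_le_mul_right hg (by positivity))

theorem orderedEigenvalue_le_of_forall_inner_le (hT : (T : H →ₗ[ℝ] H).IsSymmetric) {F : Type*}
    [AddCommGroup F] [Module ℝ F] [FiniteDimensional ℝ F] (L : H →ₗ[ℝ] F)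
    (hF : Module.finrank ℝ F < j) {C : ℝ} (hC : 0 ≤ C)
    (h : ∀ g, L g = 0 → inner ℝ (T g) g ≤ C * ‖g‖ ^ 2) : orderedEigenvalue T j ≤ C := by
  refine Real.sSup_le ?_ hC
  rintro μ ⟨-, hμ⟩
  obtain ⟨g, hg, hg0, hLg⟩ := exists_ne_zero_mem_of_natCast_le_rank hμ L hF
  have hle := (le_inner_of_mem_eigenspaceSpan hT (fun _ h => h) hg).trans (h g hLg)
  exact le_of_mul_le_mul_right hle (by positivity)

end OrderedEigenvalue

section Ostrowski

open ContinuousLinearMap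

variable {H G : Type*} [NormedAddCommGroup H] [InnerProductSpace ℝ H] [CompleteSpace H]
  [NormedAddCommGroup G] [InnerProductSpace ℝ G] [CompleteSpace G] {D : H →L[ℝ] H} {j : ℕ}

theorem le_norm_sq_mul_orderedEigenvalue_of_le_rank (hc : IsCompactOperator D) (hD : D.IsPositive)
    (A : H →L[ℝ] G) (hj : j ≠ 0) {μ : ℝ} (hμ : 0 < μ)
    (h : (j : Cardinal) ≤ Module.rank ℝ
      (eigenspaceSpan (A ∘L D ∘L adjoint A : Module.End ℝ G) (Set.Ici μ))) :
    μ ≤ ‖A‖ ^ 2 * orderedEigenvalue D j := by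
  set E := eigenspaceSpan (A ∘L D ∘L adjoint A : Module.End ℝ G) (Set.Ici μ)
  have hform : ∀ g ∈ E, μ * ‖g‖ ^ 2 ≤ inner ℝ (D (adjoint A g)) (adjoint A g) := by
    intro g hg
    rw [adjoint_inner_right]
    exact le_inner_of_mem_eigenspaceSpan (hD.conj_adjoint A).isSymmetric (fun _ h => h) hg
  have hker : ∀ g ∈ E, adjoint A g = 0 → g = 0 := by
    intro g hg hg0
    have hle := hform g hg
    rw [hg0, map_zero, inner_zero_left] at hle
    by_contra hne
    exact absurd hle (not_le.mpr (by positivity))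
  have hE : E ≠ ⊥ := by
    intro hE
    rw [hE, rank_bot] at h
    exact hj (Nat.le_zero.mp (by exact_mod_cast h))
  have hA : 0 < ‖A‖ := by
    obtain ⟨g, hg, hg0⟩ := Submodule.exists_mem_ne_zero_of_ne_bot hE
    refine norm_pos_iff.mpr fun hA => hg0 (hker g hg ?_)
    rw [hA, map_zero, zero_apply]
  have hrank : (j : Cardinal) ≤ Module.rank ℝ (E.map (adjoint A : G →ₗ[ℝ] H)) :=
    natCast_le_rank_map hker h
  rw [← div_le_iff₀' (by positivity)]
  refine le_orderedEigenvalue_of_forall_mem_le_inner hc hD.isSymmetric hj hrank ?_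
  rintro _ ⟨g, hg, rfl⟩
  have hnorm : ‖adjoint A g‖ ≤ ‖A‖ * ‖g‖ := by
    simpa only [LinearIsometryEquiv.norm_map] using (adjoint A).le_opNorm g
  calc μ / ‖A‖ ^ 2 * ‖adjoint A g‖ ^ 2 ≤ μ / ‖A‖ ^ 2 * (‖A‖ * ‖g‖) ^ 2 := by gcongr
    _ = μ * ‖g‖ ^ 2 := by field_simp
    _ ≤ inner ℝ (D (adjoint A g)) (adjoint A g) := hform g hg

theorem orderedEigenvalue_conj_adjoint_le (hc : IsCompactOperator D) (hD : D.IsPositive)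
    (A : H →L[ℝ] G) (hj : j ≠ 0) :
    orderedEigenvalue (A ∘L D ∘L adjoint A) j ≤ ‖A‖ ^ 2 * orderedEigenvalue D j := by
  have hnonneg : 0 ≤ ‖A‖ ^ 2 * orderedEigenvalue D j :=
    mul_nonneg (sq_nonneg _) (orderedEigenvalue_nonneg hD)
  refine Real.sSup_le ?_ hnonneg
  rintro μ ⟨-, hrank⟩
  rcases le_or_gt μ 0 with hμ | hμ
  · exact hμ.trans hnonneg
  · exact le_norm_sq_mul_orderedEigenvalue_of_le_rank hc hD A hj hμ hrank

theorem orderedEigenvalue_le_conj_adjoint (hc : IsCompactOperator D) (hD : D.IsPositive)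
    {A : H →L[ℝ] G} {B : G →L[ℝ] H} (hBA : B ∘L A = ContinuousLinearMap.id ℝ H) (hj : j ≠ 0) :
    orderedEigenvalue D j ≤ ‖B‖ ^ 2 * orderedEigenvalue (A ∘L D ∘L adjoint A) j := by
  have hcompact : IsCompactOperator (A ∘L D ∘L adjoint A) := (hc.comp_clm (adjoint A)).clm_comp A
  have hconj : B ∘L (A ∘L D ∘L adjoint A) ∘L adjoint B = D := by
    calc B ∘L (A ∘L D ∘L adjoint A) ∘L adjoint B
        = (B ∘L A) ∘L D ∘L adjoint (B ∘L A) := by rw [adjoint_comp]; rfl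
      _ = D := by rw [hBA, adjoint_id, id_comp, comp_id]
  calc orderedEigenvalue D j
      = orderedEigenvalue (B ∘L (A ∘L D ∘L adjoint A) ∘L adjoint B) j := by rw [hconj]
    _ ≤ _ := orderedEigenvalue_conj_adjoint_le hcompact (hD.conj_adjoint A) B hj

end Ostrowski

section DiagonalOperator

open InnerProductSpace Module.End

variable {H : Type*} [NormedAddCommGroup H] [InnerProductSpace ℝ H] {ι : Type*}

/-- The operator `g ↦ ∑ i, a i ⟪b i, g⟫ b i`, which is diagonal in the orthonormal family `b` with
diagonal entries `a`. The series is taken in the operator norm; the sum is `0` if it diverges. -/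
noncomputable def diagonalOperator (a : ι → ℝ) (b : ι → H) : H →L[ℝ] H :=
  ∑' i, a i • rankOne ℝ (b i) (b i)

variable [CompleteSpace H] {a : ι → ℝ} {b : ι → H}

theorem hasSum_diagonalOperator (hb : Orthonormal ℝ b) (ha : Summable a) :
    HasSum (fun i => a i • rankOne ℝ (b i) (b i)) (diagonalOperator a b) := by
  refine (Summable.of_norm (ha.abs.congr fun i => ?_)).hasSum
  rw [norm_smul, norm_rankOne, hb.norm_eq_one, mul_one, mul_one, Real.norm_eq_abs]

theorem hasSum_diagonalOperator_apply (hb : Orthonormal ℝ b) (ha : Summable a) (g : H) :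
    HasSum (fun i => (a i * inner ℝ (b i) g) • b i) (diagonalOperator a b g) := by
  simpa [mul_smul] using (hasSum_diagonalOperator hb ha).mapL (ContinuousLinearMap.apply ℝ H g)

theorem hasSum_inner_diagonalOperator (hb : Orthonormal ℝ b) (ha : Summable a) (g : H) :
    HasSum (fun i => a i * inner ℝ (b i) g ^ 2) (inner ℝ (diagonalOperator a b g) g) := by
  have h := (hasSum_diagonalOperator_apply hb ha g).mapL (innerSL ℝ g)
  simp only [innerSL_apply_apply, inner_smul_right, mul_assoc] at h
  simpa only [sq, real_inner_comm g] using h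

theorem diagonalOperator_apply_self (hb : Orthonormal ℝ b) (ha : Summable a) (i : ι) :
    diagonalOperator a b (b i) = a i • b i := by
  refine (hasSum_diagonalOperator_apply hb ha (b i)).unique ?_
  convert hasSum_single i fun k hk => ?_ using 1
  · rw [real_inner_self_eq_norm_sq, hb.norm_eq_one, one_pow, mul_one]
  · rw [hb.inner_eq_zero hk, mul_zero, zero_smul]

theorem isCompactOperator_diagonalOperator (hb : Orthonormal ℝ b) (ha : Summable a) :
    IsCompactOperator (diagonalOperator a b) := by
  refine isCompactOperator_of_tendsto (hasSum_diagonalOperator hb ha)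
    (Eventually.of_forall fun s => ?_)
  refine Submodule.sum_mem (compactOperator (RingHom.id ℝ) H H) fun i _ =>
    Submodule.smul_mem _ _ ?_
  change IsCompactOperator (rankOne ℝ (b i) (b i))
  rw [rankOne_def']
  exact (isCompactOperator_of_locallyCompactSpace_dom (innerSL ℝ (b i))).clm_comp
    (ContinuousLinearMap.toSpanSingleton ℝ (b i))

theorem isPositive_diagonalOperator (hb : Orthonormal ℝ b) (ha : Summable a)
    (hnonneg : ∀ i, 0 ≤ a i) : (diagonalOperator a b).IsPositive := by
  rw [ContinuousLinearMap.isPositive_iff']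
  refine ⟨?_, fun g => (hasSum_inner_diagonalOperator hb ha g).nonneg fun i =>
    mul_nonneg (hnonneg i) (sq_nonneg _)⟩
  have hself (i : ι) : star (a i • rankOne ℝ (b i) (b i)) = a i • rankOne ℝ (b i) (b i) :=
    ((isPositive_rankOne_self (b i)).smul_of_nonneg (hnonneg i)).isSelfAdjoint
  rw [IsSelfAdjoint, diagonalOperator, tsum_star]
  exact tsum_congr hself

theorem inner_diagonalOperator_le (hb : Orthonormal ℝ b) (ha : Summable a) {c : ℝ} (hc : 0 ≤ c)
    {g : H} (hg : ∀ i, inner ℝ (b i) g ≠ 0 → a i ≤ c) :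
    inner ℝ (diagonalOperator a b g) g ≤ c * ‖g‖ ^ 2 := by
  have hterm : ∀ i, a i * inner ℝ (b i) g ^ 2 ≤ c * ‖inner ℝ (b i) g‖ ^ 2 := by
    intro i
    rw [Real.norm_eq_abs, sq_abs]
    by_cases h : inner ℝ (b i) g = 0
    · simp [h]
    · exact mul_le_mul_of_nonneg_right (hg i h) (sq_nonneg _)
  calc inner ℝ (diagonalOperator a b g) g
      ≤ c * ∑' i, ‖inner ℝ (b i) g‖ ^ 2 :=
        hasSum_le hterm (hasSum_inner_diagonalOperator hb ha g)
          ((hb.inner_products_summable g).hasSum.mul_left c)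
    _ ≤ c * ‖g‖ ^ 2 := mul_le_mul_of_nonneg_left (hb.tsum_inner_products_le g) hc

theorem le_orderedEigenvalue_diagonalOperator {a : ℕ+ → ℝ} {b : ℕ+ → H} (hb : Orthonormal ℝ b)
    (ha : Summable a) (hanti : Antitone a) (j : ℕ+) :
    a j ≤ orderedEigenvalue (diagonalOperator a b) j := by
  refine le_orderedEigenvalue_of_le_rank j.ne_zero ?_
  set E := eigenspaceSpan (diagonalOperator a b : Module.End ℝ H) (Set.Ici (a j))
  have hmem (i : Finset.Icc 1 j) : b i ∈ E :=
    eigenspace_le_eigenspaceSpan (hanti (Finset.mem_Icc.mp i.2).2)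
      (mem_eigenspace_iff.mpr (diagonalOperator_apply_self hb ha i))
  have hindep : LinearIndependent ℝ fun i : Finset.Icc 1 j => (⟨b i, hmem i⟩ : E) :=
    LinearIndependent.of_comp E.subtype
      (hb.linearIndependent.comp _ Subtype.val_injective)
  have hcard : Fintype.card (Finset.Icc 1 j) = j := by
    rw [Fintype.card_coe, PNat.card_Icc]
    simp
  have hrank := hindep.cardinal_lift_le_rank
  rwa [Cardinal.mk_fintype, hcard, Cardinal.lift_natCast, Cardinal.lift_uzero] at hrank

theorem orderedEigenvalue_diagonalOperator_le {a : ℕ+ → ℝ} {b : ℕ+ → H} (hb : Orthonormal ℝ b)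
    (ha : Summable a) (hanti : Antitone a) (hnonneg : ∀ i, 0 ≤ a i) (j : ℕ+) :
    orderedEigenvalue (diagonalOperator a b) j ≤ a j := by
  let L : H →ₗ[ℝ] Finset.Ico 1 j → ℝ := LinearMap.pi fun i => (innerSL ℝ (b i) : H →ₗ[ℝ] ℝ)
  refine orderedEigenvalue_le_of_forall_inner_le
    (isPositive_diagonalOperator hb ha hnonneg).isSymmetric L ?_ (hnonneg j) fun g hg => ?_
  · rw [Module.finrank_pi, Fintype.card_coe, PNat.card_Ico]
    exact Nat.sub_lt j.pos one_pos
  · refine inner_diagonalOperator_le hb ha (hnonneg j) fun i hi =>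
      hanti (not_lt.mp fun hij => hi ?_)
    exact congrFun hg ⟨i, Finset.mem_Ico.mpr ⟨one_le, hij⟩⟩

end DiagonalOperator

section Covariance

variable {X ι : Type*} [MeasurableSpace X] [Countable ι] {ρ : Measure X} {a : ι → ℝ}
  {φ : ι → Lp ℝ 2 ρ} {ψ : ι → X → ℝ}

theorem coeFn_tsum_smul_ae_eq {c : ι → ℝ} (hφ : ∀ i, φ i =ᵐ[ρ] ψ i)
    (hc : Summable fun i => |c i| * ‖φ i‖) :
    (∑' i, c i • φ i : Lp ℝ 2 ρ) =ᵐ[ρ] fun x => ∑' i, c i * ψ i x := by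
  have hnorm : Summable fun i => ‖c i • φ i‖ := by
    simpa only [norm_smul, Real.norm_eq_abs] using hc
  have hsum := Lp.coeFn_tsum (tsum_enorm_ne_top_iff_summable_norm.mpr hnorm)
  have hterm : ∀ᵐ x ∂ρ, ∀ i, (c i • φ i : Lp ℝ 2 ρ) x = c i * ψ i x := by
    refine ae_all_iff.mpr fun i => ?_
    filter_upwards [Lp.coeFn_smul (c i) (φ i), hφ i] with x hsmul hx
    rw [hsmul, Pi.smul_apply, hx, smul_eq_mul]
  filter_upwards [hsum, hterm] with x hx hterm
  rw [hx]
  exact tsum_congr hterm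

theorem isCovarianceOperator_of_apply_eq_tsum (hφ : ∀ i, φ i =ᵐ[ρ] ψ i)
    (ha : Summable fun i => |a i| * ‖φ i‖ ^ 2)
    (haψ : ∀ x, Summable fun i => |a i * ψ i x| * ‖φ i‖) {T : Lp ℝ 2 ρ →L[ℝ] Lp ℝ 2 ρ}
    (hT : ∀ g, T g = ∑' i, (a i * inner ℝ (φ i) g) • φ i) :
    IsCovarianceOperator ρ (fun x y => ∑' i, a i * ψ i x * ψ i y) T := by
  intro g
  -- `k x` is the class of the section `K(·, x)`, so `∫ g K(·, x) dρ` is the inner product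
  -- `⟪k x, g⟫` and no exchange of sum and integral is needed.
  let k (x : X) : Lp ℝ 2 ρ := ∑' i, (a i * ψ i x) • φ i
  have hk (x : X) : (fun τ => inner ℝ (k x τ) (g τ)) =ᵐ[ρ]
      fun τ => g τ * ∑' i, a i * ψ i τ * ψ i x := by
    filter_upwards [coeFn_tsum_smul_ae_eq hφ (haψ x)] with τ hτ
    change g τ * k x τ = _
    rw [hτ]
    simp only [mul_right_comm]
  have hinner (x : X) : inner ℝ (k x) g = ∑' i, a i * inner ℝ (φ i) g * ψ i x := by
    have hsum : Summable fun i => (a i * ψ i x) • φ i :=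
      Summable.of_norm (by simpa only [norm_smul, Real.norm_eq_abs] using haψ x)
    have h := hsum.hasSum.mapL (innerSL ℝ g)
    simp only [innerSL_apply_apply, inner_smul_right] at h
    rw [real_inner_comm, ← h.tsum_eq]
    simp only [real_inner_comm g, mul_right_comm]
  have haφ : Summable fun i => |a i * inner ℝ (φ i) g| * ‖φ i‖ := by
    refine (ha.mul_right ‖g‖).of_nonneg_of_le (fun i => by positivity) fun i => ?_
    calc |a i * inner ℝ (φ i) g| * ‖φ i‖ ≤ |a i| * (‖φ i‖ * ‖g‖) * ‖φ i‖ := by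
          rw [abs_mul]
          gcongr
          exact abs_real_inner_le_norm _ _
      _ = |a i| * ‖φ i‖ ^ 2 * ‖g‖ := by ring
  refine ⟨fun x => (L2.integrable_inner (k x) g).congr (hk x), ?_⟩
  filter_upwards [hT g ▸ coeFn_tsum_smul_ae_eq hφ haφ] with x hx
  rw [hx, ← hinner, L2.inner_def, integral_congr_ae (hk x)]

theorem isCovarianceOperator_conj_diagonalOperator {H : Type*} [NormedAddCommGroup H]
    [InnerProductSpace ℝ H] [CompleteSpace H] {b : ι → H} (hb : Orthonormal ℝ b)
    (ha : Summable a) (A : H →L[ℝ] Lp ℝ 2 ρ) (hψ : ∀ i, A (b i) =ᵐ[ρ] ψ i)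
    (hbdd : ∀ x, ∃ M, ∀ i, |ψ i x| ≤ M) :
    IsCovarianceOperator ρ (fun x y => ∑' i, a i * ψ i x * ψ i y)
      (A ∘L diagonalOperator a b ∘L A.adjoint) := by
  have hnorm (i : ι) : ‖A (b i)‖ ≤ ‖A‖ := by
    simpa only [hb.norm_eq_one, mul_one] using A.le_opNorm (b i)
  refine isCovarianceOperator_of_apply_eq_tsum hψ ?_ (fun x => ?_) fun g => ?_
  · refine (ha.abs.mul_right (‖A‖ ^ 2)).of_nonneg_of_le (fun i => by positivity) fun i => ?_
    gcongr
    exact hnorm i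
  · obtain ⟨M, hM⟩ := hbdd x
    refine (ha.abs.mul_right (M * ‖A‖)).of_nonneg_of_le (fun i => by positivity) fun i => ?_
    rw [abs_mul, mul_assoc]
    have hM0 : 0 ≤ M := (abs_nonneg _).trans (hM i)
    gcongr
    exacts [hM i, hnorm i]
  · have h := (hasSum_diagonalOperator_apply hb ha (A.adjoint g)).mapL A
    simp only [map_smul, ContinuousLinearMap.adjoint_inner_right] at h
    exact h.tsum_eq.symm

end Covariance

section Measures

variable {X : Type*} [MeasurableSpace X] {ρ ν : Measure X} {ℓ u : ℝ}

theorem HasDensityBetween.withDensity_eq (hℓ : 0 < ℓ) (h : HasDensityBetween ρ ν ℓ u) :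
    ν.withDensity (ρ.rnDeriv ν) = ρ := by
  have hleb : ρ.HaveLebesgueDecomposition ν := by
    by_contra hn
    -- Here `ρ.rnDeriv ν` has the junk value `0`, which lies below `ℓ`.
    have hbounds := h.bounds
    rw [Measure.rnDeriv_of_not_haveLebesgueDecomposition hn] at hbounds
    have hν : ν = 0 := by
      rw [← ae_eq_bot, ← empty_mem_iff_bot]
      filter_upwards [hbounds] with x hx
      exact absurd hx.1 (by simpa using hℓ)
    have hρ : ρ = 0 := Measure.absolutelyContinuous_zero_iff.mp (hν ▸ h.absolutelyContinuous)
    exact hn (hρ ▸ inferInstance)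
  exact Measure.withDensity_rnDeriv_eq ρ ν h.absolutelyContinuous

theorem HasDensityBetween.le_smul (hℓ : 0 < ℓ) (h : HasDensityBetween ρ ν ℓ u) :
    ρ ≤ ENNReal.ofReal u • ν := by
  conv_lhs => rw [← h.withDensity_eq hℓ]
  rw [← withDensity_const]
  exact withDensity_mono (h.bounds.mono fun x hx => hx.2)

theorem HasDensityBetween.le_inv_smul (hℓ : 0 < ℓ) (h : HasDensityBetween ρ ν ℓ u) :
    ν ≤ ENNReal.ofReal ℓ⁻¹ • ρ := by
  have hle : ENNReal.ofReal ℓ • ν ≤ ρ := by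
    conv_rhs => rw [← h.withDensity_eq hℓ]
    rw [← withDensity_const]
    exact withDensity_mono (h.bounds.mono fun x hx => hx.1)
  calc ν = ENNReal.ofReal ℓ⁻¹ • ENNReal.ofReal ℓ • ν := by
        rw [smul_smul, ← ENNReal.ofReal_mul (by positivity), inv_mul_cancel₀ hℓ.ne',
          ENNReal.ofReal_one, one_smul]
    _ ≤ ENNReal.ofReal ℓ⁻¹ • ρ := by gcongr

theorem norm_sq_LpToLpOfMeasureLeSMul_le {E : Type*} [NormedAddCommGroup E] [NormedSpace ℝ E]
    {c : ℝ} (hc : 0 ≤ c) (h : ρ ≤ ENNReal.ofReal c • ν) :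
    ‖(Lp.LpToLpOfMeasureLeSMul ENNReal.ofReal_ne_top h : Lp E 2 ν →L[ℝ] Lp E 2 ρ)‖ ^ 2 ≤ c := by
  calc _ ≤ (√c) ^ 2 := by
        gcongr
        refine (Lp.norm_LpToLpOfMeasureLeSMul_le _ h).trans_eq ?_
        rw [ENNReal.toReal_ofReal hc, Real.sqrt_eq_rpow]
        simp
    _ = c := Real.sq_sqrt hc

theorem LpToLpOfMeasureLeSMul_comp_eq_id {E : Type*} [NormedAddCommGroup E] [NormedSpace ℝ E]
    {p : ENNReal} [Fact (1 ≤ p)] {c c' : ENNReal} (hc : c ≠ ⊤) (hc' : c' ≠ ⊤)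
    (h : ρ ≤ c • ν) (h' : ν ≤ c' • ρ) :
    (Lp.LpToLpOfMeasureLeSMul hc' h' : Lp E p ρ →L[ℝ] Lp E p ν) ∘L
      Lp.LpToLpOfMeasureLeSMul hc h = ContinuousLinearMap.id ℝ _ := by
  refine ContinuousLinearMap.ext fun f => Lp.ext ?_
  rw [ContinuousLinearMap.comp_apply]
  exact (Lp.coeFn_LpToLpOfMeasureLeSMul _ h' _).trans
    ((Measure.absolutelyContinuous_of_le_smul h').ae_eq (Lp.coeFn_LpToLpOfMeasureLeSMul _ h f))

end Measures

section Sieve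

variable {X : Type*} [MeasurableSpace X] {ν ρ : Measure X} {ℓ u : ℝ} {ψ : ℕ+ → X → ℝ}

theorem exists_isCovarianceOperator_orderedEigenvalue_bounds (hℓ : 0 < ℓ) (hℓu : ℓ ≤ u)
    (hρ : HasDensityBetween ρ ν ℓ u) {b : ℕ+ → Lp ℝ 2 ν} (hb : Orthonormal ℝ b)
    (hbψ : ∀ j, b j =ᵐ[ν] ψ j) (hbdd : ∀ x, ∃ M, ∀ j, |ψ j x| ≤ M) {a : ℕ+ → ℝ}
    (ha : Summable a) (hanti : Antitone a) (hnonneg : ∀ j, 0 ≤ a j) :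
    ∃ T : Lp ℝ 2 ρ →L[ℝ] Lp ℝ 2 ρ,
      IsCovarianceOperator ρ (fun x y => ∑' j, a j * ψ j x * ψ j y) T ∧
        IsCompactOperator T ∧ T.IsPositive ∧
          ∀ j : ℕ+, ℓ * a j ≤ orderedEigenvalue T j ∧ orderedEigenvalue T j ≤ u * a j := by
  have hle := hρ.le_smul hℓ
  have hle' := hρ.le_inv_smul hℓ
  let A : Lp ℝ 2 ν →L[ℝ] Lp ℝ 2 ρ := Lp.LpToLpOfMeasureLeSMul ENNReal.ofReal_ne_top hle
  let B : Lp ℝ 2 ρ →L[ℝ] Lp ℝ 2 ν := Lp.LpToLpOfMeasureLeSMul ENNReal.ofReal_ne_top hle'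
  have hA : ‖A‖ ^ 2 ≤ u := norm_sq_LpToLpOfMeasureLeSMul_le (hℓ.le.trans hℓu) hle
  have hB : ‖B‖ ^ 2 ≤ ℓ⁻¹ := norm_sq_LpToLpOfMeasureLeSMul_le (inv_nonneg.mpr hℓ.le) hle'
  have hBA : B ∘L A = ContinuousLinearMap.id ℝ _ := LpToLpOfMeasureLeSMul_comp_eq_id _ _ hle hle'
  have hAψ (j : ℕ+) : A (b j) =ᵐ[ρ] ψ j :=
    (Lp.coeFn_LpToLpOfMeasureLeSMul _ hle _).trans (hρ.absolutelyContinuous.ae_eq (hbψ j))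
  have hcD := isCompactOperator_diagonalOperator hb ha
  have hposD := isPositive_diagonalOperator hb ha hnonneg
  have hpos := hposD.conj_adjoint A
  refine ⟨A ∘L diagonalOperator a b ∘L A.adjoint,
    isCovarianceOperator_conj_diagonalOperator hb ha A hAψ hbdd,
    (hcD.comp_clm A.adjoint).clm_comp A, hpos, fun j => ⟨?_, ?_⟩⟩
  · rw [← le_inv_mul_iff₀ hℓ]
    calc a j ≤ orderedEigenvalue (diagonalOperator a b) j :=
          le_orderedEigenvalue_diagonalOperator hb ha hanti j
      _ ≤ ‖B‖ ^ 2 * orderedEigenvalue (A ∘L diagonalOperator a b ∘L A.adjoint) j :=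
          orderedEigenvalue_le_conj_adjoint hcD hposD hBA j.ne_zero
      _ ≤ _ := mul_le_mul_of_nonneg_right hB (orderedEigenvalue_nonneg hpos)
  · calc orderedEigenvalue (A ∘L diagonalOperator a b ∘L A.adjoint) j
        ≤ ‖A‖ ^ 2 * orderedEigenvalue (diagonalOperator a b) j :=
          orderedEigenvalue_conj_adjoint_le hcD hposD A j.ne_zero
      _ ≤ u * a j := mul_le_mul hA (orderedEigenvalue_diagonalOperator_le hb ha hanti hnonneg j)
          (orderedEigenvalue_nonneg hposD) (hℓ.le.trans hℓu)

/-- The weight `j^(-2ω)` of `ψ j` in `sieveKernel ψ ω J`, cut off at `J`. -/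
noncomputable def sieveWeight (ω : ℝ) (J : ℕ∞) (j : ℕ+) : ℝ :=
  if ((j : ℕ) : ℕ∞) ≤ J then ((j : ℕ) : ℝ) ^ (-2 * ω) else 0

theorem sieveWeight_of_le (ω : ℝ) {J : ℕ∞} {j : ℕ+} (h : ((j : ℕ) : ℕ∞) ≤ J) :
    sieveWeight ω J j = ((j : ℕ) : ℝ) ^ (-2 * ω) :=
  if_pos h

theorem sieveWeight_nonneg (ω : ℝ) (J : ℕ∞) (j : ℕ+) : 0 ≤ sieveWeight ω J j := by
  unfold sieveWeight
  split_ifs <;> positivity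

theorem sieveWeight_antitone {ω : ℝ} (hω : 0 ≤ ω) (J : ℕ∞) : Antitone (sieveWeight ω J) := by
  intro i j hij
  have hij' : (i : ℕ) ≤ j := hij
  by_cases hj : ((j : ℕ) : ℕ∞) ≤ J
  · rw [sieveWeight_of_le ω hj, sieveWeight_of_le ω (le_trans (by exact_mod_cast hij') hj)]
    exact Real.rpow_le_rpow_of_nonpos (by exact_mod_cast i.pos) (by exact_mod_cast hij')
      (by linarith)
  · rw [sieveWeight, if_neg hj]
    exact sieveWeight_nonneg ω J i

theorem summable_sieveWeight {ω : ℝ} (hω : 1 / 2 < ω) (J : ℕ∞) : Summable (sieveWeight ω J) := by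
  have h : Summable fun j : ℕ+ => ((j : ℕ) : ℝ) ^ (-2 * ω) :=
    (Real.summable_nat_rpow.mpr (by linarith)).comp_injective PNat.coe_injective
  refine h.of_nonneg_of_le (sieveWeight_nonneg ω J) fun j => ?_
  unfold sieveWeight
  split_ifs
  · exact le_rfl
  · positivity

theorem sieveKernel_eq_tsum_sieveWeight {X : Type*} (ψ : ℕ+ → X → ℝ) (ω : ℝ) (J : ℕ∞) :
    sieveKernel ψ ω J = fun x y => ∑' j, sieveWeight ω J j * ψ j x * ψ j y := by
  ext x y
  refine tsum_congr fun j => ?_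
  unfold sieveWeight
  split_ifs <;> simp

theorem isTheta_of_eventually_le_mul_le {α : Type*} {l : Filter α} {f g : α → ℝ} (hℓ : 0 < ℓ)
    (hf : ∀ᶠ x in l, 0 ≤ f x) (h : ∀ᶠ x in l, ℓ * f x ≤ g x ∧ g x ≤ u * f x) : g =Θ[l] f := by
  refine ⟨IsBigO.of_bound u ?_, IsBigO.of_bound ℓ⁻¹ ?_⟩ <;>
    filter_upwards [hf, h] with x hf ⟨hle, hge⟩ <;>
    rw [Real.norm_of_nonneg hf, Real.norm_of_nonneg ((mul_nonneg hℓ.le hf).trans hle)]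
  · exact hge
  · exact (le_inv_mul_iff₀ hℓ).mpr hle

theorem exists_isCovarianceOperator_sieveKernel (hℓ : 0 < ℓ) (hℓu : ℓ ≤ u)
    (hρ : HasDensityBetween ρ ν ℓ u) {b : ℕ+ → Lp ℝ 2 ν} (hb : Orthonormal ℝ b)
    (hbψ : ∀ j, b j =ᵐ[ν] ψ j) (hbdd : ∀ x, ∃ M, ∀ j, |ψ j x| ≤ M) {ω : ℝ} (hω : 1 / 2 < ω)
    (J : ℕ∞) :
    ∃ T : Lp ℝ 2 ρ →L[ℝ] Lp ℝ 2 ρ,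
      IsCovarianceOperator ρ (sieveKernel ψ ω J) T ∧ IsCompactOperator T ∧ T.IsPositive ∧
        ∀ j : ℕ, 1 ≤ j → (j : ℕ∞) ≤ J →
          ℓ * (j : ℝ) ^ (-2 * ω) ≤ orderedEigenvalue T j ∧
            orderedEigenvalue T j ≤ u * (j : ℝ) ^ (-2 * ω) := by
  obtain ⟨T, hT, hc, hpos, hbounds⟩ := exists_isCovarianceOperator_orderedEigenvalue_bounds
    hℓ hℓu hρ hb hbψ hbdd (summable_sieveWeight hω J) (sieveWeight_antitone (by linarith) J)
    (sieveWeight_nonneg ω J)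
  refine ⟨T, by rwa [sieveKernel_eq_tsum_sieveWeight], hc, hpos, fun j hj hjJ => ?_⟩
  lift j to ℕ+ using hj
  simpa only [sieveWeight_of_le ω hjJ] using hbounds j

theorem lemma6p2_general {s : ℝ} (hℓ : 0 < ℓ) (hℓu : ℓ ≤ u) (hs : 1 / 2 < s)
    (hρ : HasDensityBetween ρ ν ℓ u) {b : ℕ+ → Lp ℝ 2 ν} (hb : Orthonormal ℝ b)
    (hbψ : ∀ j, b j =ᵐ[ν] ψ j) (hbdd : ∀ x, ∃ M, ∀ j, |ψ j x| ≤ M) :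
    (∃ T : Lp ℝ 2 ρ →L[ℝ] Lp ℝ 2 ρ,
      IsCovarianceOperator ρ (sieveKernel ψ s ⊤) T ∧ IsCompactOperator T ∧ T.IsPositive ∧
        (fun j : ℕ => orderedEigenvalue T j) =Θ[atTop] (fun j : ℕ => (j : ℝ) ^ (-2 * s))) ∧
    (∀ ω : ℝ, 1 / 2 < ω → ∀ J : ℕ∞,
      ∃ T : Lp ℝ 2 ρ →L[ℝ] Lp ℝ 2 ρ,
        IsCovarianceOperator ρ (sieveKernel ψ ω J) T ∧ IsCompactOperator T ∧ T.IsPositive ∧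
          ∀ j : ℕ, 1 ≤ j → (j : ℕ∞) ≤ J →
            ℓ * (j : ℝ) ^ (-2 * ω) ≤ orderedEigenvalue T j ∧
              orderedEigenvalue T j ≤ u * (j : ℝ) ^ (-2 * ω)) := by
  refine ⟨?_, fun ω hω J => exists_isCovarianceOperator_sieveKernel hℓ hℓu hρ hb hbψ hbdd hω J⟩
  obtain ⟨T, hT, hc, hpos, hbounds⟩ :=
    exists_isCovarianceOperator_sieveKernel hℓ hℓu hρ hb hbψ hbdd hs ⊤
  refine ⟨T, hT, hc, hpos, isTheta_of_eventually_le_mul_le (u := u) hℓ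
    (.of_forall fun j => by positivity) ?_⟩
  filter_upwards [eventually_ge_atTop 1] with j hj using hbounds j hj le_top

end Sieve

theorem lemma6p2 {X : Type*} [TopologicalSpace X] [MeasurableSpace X] [BorelSpace X]
    (ν ρ : Measure X) [IsProbabilityMeasure ρ] (ℓ u M s : ℝ) (ψ : ℕ+ → X → ℝ)
    (hℓ : 0 < ℓ) (hℓu : ℓ ≤ u) (hs : 1 < s)
    (hρ : HasDensityBetween ρ ν ℓ u) (hψ : IsBoundedContinuousBasis ν M ψ) :
    (∃ T : Lp ℝ 2 ρ →L[ℝ] Lp ℝ 2 ρ,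
      IsCovarianceOperator ρ (sieveKernel ψ s ⊤) T ∧ IsCompactOperator T ∧ T.IsPositive ∧
        (fun j : ℕ => orderedEigenvalue T j) =Θ[atTop] (fun j : ℕ => (j : ℝ) ^ (-2 * s))) ∧
    (∀ ω : ℝ, 1 / 2 < ω → ∀ J : ℕ∞, 1 ≤ J →
      ∃ T : Lp ℝ 2 ρ →L[ℝ] Lp ℝ 2 ρ,
        IsCovarianceOperator ρ (sieveKernel ψ ω J) T ∧ IsCompactOperator T ∧ T.IsPositive ∧
          ∀ j : ℕ, 1 ≤ j → (j : ℕ∞) ≤ J →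
            ℓ * (j : ℝ) ^ (-2 * ω) ≤ orderedEigenvalue T j ∧
              orderedEigenvalue T j ≤ u * (j : ℝ) ^ (-2 * ω)) := by
  obtain ⟨b, hb⟩ := hψ.basis
  obtain ⟨hΘ, hbounds⟩ := lemma6p2_general hℓ hℓu (by linarith : 1 / 2 < s) hρ b.orthonormal hb
    fun x => ⟨M, fun j => hψ.bounded j x⟩
  exact ⟨hΘ, fun ω hω J _ => hbounds ω hω J⟩
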